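/- Let $G$ be a finite group and let $D \subseteq G$ be a regular $(v,k,\lambda,\mu)$-partial difference set: $|G| = v$, $|D| = k$, $D = D^{-1}$, $1 \notin D$, and every nonidentity $g \in G$ can be written as $g = xy^{-1}$ with $x, y \in D$ in exactly $\lambda$ ways if $g \in D$ and in exactly $\mu$ ways if $g \notin D$. Assume $0 < \mu < k$. Let $\Delta = (\lambda-\mu)^2 + 4(k-\mu)$ and assume that $\sqrt{\Delta}$ is an integer; put $\theta_1 = \frac{1}{2}(\lambda - \mu + \sqrt{\Delta})$ and $\theta_2 = \frac{1}{2}(\lambda-\mu-\sqrt{\Delta})$. Let $\mathcal{L}$ be the group of linear characters $G \to \mathbb{C}^\times$ and write $\xi(D) = \sum_{d \in D} \xi(d)$ for $\xi \in \mathcal{L}$. (a) Let $H \le \mathcal{L}$ be a subgroup whose order is coprime to $\sqrt{\Delta}$, let $N = \bigcap_{\xi \in H} \ker \xi$, and suppose that $N$ is a proper subgroup of $G$. Then there is $\theta_\alpha \in \{\theta_1, \theta_2\}$ such that $\xi(D) = \theta_\alpha$ for every nonprincipal $\xi \in H$, and $$|Na \cap D| = \frac{k - \theta_\alpha}{|H|}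 \qquad \text{for every } a \in G \setminus N.$$ (b) In particular, if $\gcd(v, \sqrt{\Delta}) = 1$ and $G' = [G,G]$, then there is $\theta_\alpha \in \{\theta_1,\theta_2\}$ such that $\xi(D) = \theta_\alpha$ for every nonprincipal $\xi \in \mathcal{L}$, and $$|G'a \cap D| = \frac{k-\theta_\alpha}{|\mathcal{L}|} \qquad \text{for every } a \in G \setminus G'.$$ -/

import Mathlib

namespace PartialDifference

/-- `D` is a `(v, k, lam, mu)`-partial difference set in the group `G`: `G` has order `v`, `D` has
size `k`, and every nonidentity `g` is written as `x * y⁻¹` with `x, y ∈ D` in exactly `lam` ways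
if `g ∈ D` and in exactly `mu` ways if `g ∉ D`. -/
structure IsPDS {G : Type*} [Group G] (D : Finset G) (v k lam mu : ℕ) : Prop where
  card_group : Nat.card G = v
  card_set : D.card = k
  count_mem : ∀ g : G, g ≠ 1 → g ∈ D →
    {p : G × G | p.1 ∈ D ∧ p.2 ∈ D ∧ p.1 * p.2⁻¹ = g}.ncard = lam
  count_not_mem : ∀ g : G, g ≠ 1 → g ∉ D →
    {p : G × G | p.1 ∈ D ∧ p.2 ∈ D ∧ p.1 * p.2⁻¹ = g}.ncard = mu

/-- A partial difference set is regular if it is closed under inverses and does not contain the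
identity. -/
structure IsRegularPDS {G : Type*} [Group G] (D : Finset G) (v k lam mu : ℕ) : Prop
    extends IsPDS D v k lam mu where
  inv_mem : ∀ g ∈ D, g⁻¹ ∈ D
  one_not_mem : (1 : G) ∉ D

/-- The discriminant `Δ = (lam - mu)² + 4 (k - mu)`. -/
def discr (k lam mu : ℕ) : ℤ := ((lam : ℤ) - mu) ^ 2 + 4 * ((k : ℤ) - mu)

/-- The eigenvalue `θ₁ = (lam - mu + √Δ) / 2`. -/
noncomputable def theta₁ (k lam mu : ℕ) : ℝ :=
  ((lam : ℝ) - mu + Real.sqrt (discr k lam mu : ℝ)) / 2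

/-- The eigenvalue `θ₂ = (lam - mu - √Δ) / 2`. -/
noncomputable def theta₂ (k lam mu : ℕ) : ℝ :=
  ((lam : ℝ) - mu - Real.sqrt (discr k lam mu : ℝ)) / 2

/-- The group of (complex) linear characters of `G`, under pointwise multiplication;
its identity is the principal character. -/
abbrev LinChar (G : Type*) [Group G] : Type _ := G →* ℂˣ

/-- The value `ξ(D) = ∑ d ∈ D, ξ(d)` of a linear character on a finite subset. -/
noncomputable def charSum {G : Type*} [Group G] (ξ : LinChar G) (D : Finset G) : ℂ :=
  ∑ d ∈ D, ((ξ d : ℂˣ) : ℂ)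

/-- The intersection of the kernels of the characters in `H`. -/
def kerInter {G : Type*} [Group G] (H : Subgroup (LinChar G)) : Subgroup G :=
  ⨅ ξ ∈ H, MonoidHom.ker ξ

/-- The right coset `N a = {n * a | n ∈ N}`. -/
def rCoset {G : Type*} [Group G] (N : Subgroup G) (a : G) : Set G :=
  (fun n : G => n * a) '' (N : Set G)

end PartialDifference

/-! In the group ring `D * D⁻¹` is a combination of `G`, `D` and `1`, so `ξ(D)` is a root of a
quadratic for every nonprincipal `ξ`, hence `θ₁` or `θ₂`, integers with `θ₁ - θ₂ = s`. Let `T` be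
the set of nonprincipal `ξ ∈ H` with `ξ(D) = θ₂`, and let `r = |T|`, `n = |H|`. Fourier inversion
over `H` makes `s * ∑ ξ ∈ T, ξ g` an integer that is constant modulo `n`. By integrality and
coprimality, `x g = ∑ ξ ∈ T, ξ g` is an integer congruent to `r` modulo `n`; since `|x g| ≤ r < n`,
it is `r` or `r - n`. Orthogonality gives the mean of `x` as `0` and of `x²` as `r`, which forces `r
= 0` or `r = n - 1` (`card_eq_zero_or_card_add_one_eq`): `T` is empty or everything nonprincipal.
Inversion with this constant value then yields the coset counts. -/

namespace PartialDifference

open Finset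

/-! ### Duality and orthogonality for linear characters. -/

section LinearCharacters

variable {G : Type*} [Group G]

/-- Linear characters factor through the finite abelianization. -/
lemma finite_linChar [Finite G] : Finite (LinChar G) := by
  have : Finite (Abelianization G) := Quotient.finite _
  -- This supplies the roots of unity in `ℂ` on which duality for the abelianization depends.
  have : NeZero ((Monoid.exponent (Abelianization G) : ℕ) : ℂ) :=
    ⟨Nat.cast_ne_zero.2 Monoid.exponent_ne_zero_of_finite⟩
  have : Finite (Abelianization G →* ℂˣ) := Finite.of_equiv _
    (CommGroup.monoidHom_mulEquiv_of_hasEnoughRootsOfUnity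
      (Abelianization G) ℂ).some.symm.toEquiv
  exact Finite.of_equiv _ (Abelianization.lift (G := G) (A := ℂˣ)).symm

lemma card_linChar [Finite G] : Nat.card (LinChar G) = Nat.card (Abelianization G) := by
  have : Finite (Abelianization G) := Quotient.finite _
  have : NeZero ((Monoid.exponent (Abelianization G) : ℕ) : ℂ) :=
    ⟨Nat.cast_ne_zero.2 Monoid.exponent_ne_zero_of_finite⟩
  rw [Nat.card_congr (Abelianization.lift (G := G) (A := ℂˣ)),
    CommGroup.card_monoidHom_of_hasEnoughRootsOfUnity]

lemma mem_kerInter {H : Subgroup (LinChar G)} {g : G} :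
    g ∈ kerInter H ↔ ∀ ξ ∈ H, ξ g = 1 := by
  simp [kerInter, Subgroup.mem_iInf, MonoidHom.mem_ker]

/-- Characters of a finite abelian group separate points; apply this to the abelianization. -/
lemma kerInter_top [Finite G] : kerInter (⊤ : Subgroup (LinChar G)) = commutator G := by
  have : Finite (Abelianization G) := Quotient.finite _
  have : NeZero ((Monoid.exponent (Abelianization G) : ℕ) : ℂ) :=
    ⟨Nat.cast_ne_zero.2 Monoid.exponent_ne_zero_of_finite⟩
  ext g
  rw [mem_kerInter]
  constructor
  · intro h
    rw [← Abelianization.ker_of, MonoidHom.mem_ker]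
    by_contra hg
    obtain ⟨φ, hφ⟩ :=
      CommGroup.exists_apply_ne_one_of_hasEnoughRootsOfUnity (Abelianization G) ℂ hg
    exact hφ (h (φ.comp Abelianization.of) (Subgroup.mem_top _))
  · intro hg ξ _
    exact MonoidHom.mem_ker.1 (Abelianization.commutator_subset_ker ξ hg)

lemma sum_linChar_eq_zero [Fintype G] {ξ : LinChar G} (hξ : ξ ≠ 1) :
    ∑ g : G, ((ξ g : ℂˣ) : ℂ) = 0 := by
  refine sum_hom_units_eq_zero ((Units.coeHom ℂ).comp ξ) fun h ↦ hξ ?_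
  ext g
  simpa using DFunLike.congr_fun h g

/-- Evaluation at `g` is itself a character of `H`, trivial exactly when `g` lies in every kernel.
-/
lemma sum_subgroup_apply (H : Subgroup (LinChar G)) [Fintype H] (g : G)
    [Decidable (g ∈ kerInter H)] :
    ∑ ξ : H, (((ξ : LinChar G) g : ℂˣ) : ℂ) = if g ∈ kerInter H then (Fintype.card H : ℂ) else 0 := by
  split_ifs with hg
  · rw [mem_kerInter] at hg
    simp [hg _ (Subtype.coe_prop _)]
  · refine sum_hom_units_eq_zero
      ((Units.coeHom ℂ).comp ((MonoidHom.eval g).comp H.subtype)) fun h ↦ hg ?_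
    rw [mem_kerInter]
    intro ξ hξ
    ext
    simpa using DFunLike.congr_fun h ⟨ξ, hξ⟩

lemma norm_linChar [Finite G] (ξ : LinChar G) (g : G) : ‖((ξ g : ℂˣ) : ℂ)‖ = 1 := by
  refine Complex.norm_eq_one_of_pow_eq_one (n := Nat.card G) ?_ Nat.card_pos.ne'
  rw [← Units.val_pow_eq_pow_val, ← map_pow, pow_card_eq_one', map_one, Units.val_one]

lemma isIntegral_linChar [Finite G] (ξ : LinChar G) (g : G) : IsIntegral ℤ ((ξ g : ℂˣ) : ℂ) := by
  refine IsIntegral.of_pow (n := Nat.card G) Nat.card_pos ?_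
  rw [← Units.val_pow_eq_pow_val, ← map_pow, pow_card_eq_one', map_one, Units.val_one]
  exact isIntegral_one

lemma conj_linChar [Finite G] (ξ : LinChar G) (g : G) :
    (starRingEnd ℂ) ((ξ g : ℂˣ) : ℂ) = ((ξ⁻¹ g : ℂˣ) : ℂ) := by
  rw [MonoidHom.inv_apply, Units.val_inv_eq_inv_val, Complex.inv_eq_conj (norm_linChar ξ g)]

/-- Parseval's identity for the indicator function of a set of characters. -/
lemma sum_sum_mul_conj [Fintype G] (T : Finset (LinChar G)) :
    ∑ g : G, (∑ ξ ∈ T, ((ξ g : ℂˣ) : ℂ)) * (starRingEnd ℂ) (∑ ξ ∈ T, ((ξ g : ℂˣ) : ℂ)) =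
      Fintype.card G * T.card := by
  classical
  have key : ∀ ξ η : LinChar G, ∑ g : G, ((ξ g : ℂˣ) : ℂ) * ((η⁻¹ g : ℂˣ) : ℂ) =
      if ξ = η then (Fintype.card G : ℂ) else 0 := by
    intro ξ η
    split_ifs with h
    · subst h
      simp
    · rw [← sum_linChar_eq_zero (ξ := ξ * η⁻¹) (fun h' ↦ h (mul_inv_eq_one.1 h'))]
      simp
  simp_rw [map_sum, conj_linChar, sum_mul_sum]
  rw [sum_comm]
  simp_rw [sum_comm (s := univ) (t := T), key]
  simp [mul_comm]

end LinearCharacters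

/-! ### Integrality and rigidity of character sums. -/

/-- An algebraic integer with a nonzero integral multiple in `ℤ` is an integer. -/
lemma exists_intCast_eq_of_isIntegral {x : ℂ} (hx : IsIntegral ℤ x) {s z : ℤ} (hs : s ≠ 0)
    (h : (s : ℂ) * x = z) : ∃ m : ℤ, x = m := by
  have hq : x = algebraMap ℚ ℂ (z / s) := by
    have : (s : ℂ) ≠ 0 := by exact_mod_cast hs
    simp only [eq_ratCast, Rat.cast_div, Rat.cast_intCast]
    rw [← h]
    field_simp
  rw [hq, isIntegral_algebraMap_iff (algebraMap ℚ ℂ).injective,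
    IsIntegrallyClosed.isIntegral_iff] at hx
  obtain ⟨m, hm⟩ := hx
  exact ⟨m, by rw [hq, ← hm]; simp⟩

/-- If the values of a sum of `r` distinct nonprincipal characters, where `r < n`, are integers
congruent to `r` modulo `n`, then `r = 0` or `r = n - 1`. -/
lemma card_eq_zero_or_card_add_one_eq {G : Type*} [Group G] [Finite G] (T : Finset (LinChar G))
    (hT : 1 ∉ T) {n : ℕ} (hn : T.card < n) (x : G → ℤ)
    (hx : ∀ g, ∑ ξ ∈ T, ((ξ g : ℂˣ) : ℂ) = x g) (hdvd : ∀ g, (n : ℤ) ∣ x g - T.card) :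
    T.card = 0 ∨ T.card + 1 = n := by
  have : Fintype G := Fintype.ofFinite G
  have hsum : ∑ g, x g = 0 := by
    have : ∑ g, (x g : ℂ) = 0 := by
      simp_rw [← hx]
      rw [sum_comm]
      exact sum_eq_zero fun ξ hξ ↦ sum_linChar_eq_zero fun h ↦ hT (h ▸ hξ)
    exact_mod_cast this
  have hsq : ∑ g, x g * x g = Fintype.card G * T.card := by
    have := sum_sum_mul_conj T
    simp_rw [hx, map_intCast] at this
    exact_mod_cast this
  have habs : ∀ g, |x g| ≤ T.card := by
    intro g
    have h : ‖(x g : ℂ)‖ ≤ T.card := by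
      rw [← hx]
      refine (norm_sum_le _ _).trans ?_
      simp [norm_linChar]
    rw [Complex.norm_intCast] at h
    exact_mod_cast h
  -- The only possible values are `r` and `r - n`, with `r = T.card`; this is the quadratic with
  -- those roots.
  have hval : ∀ g, x g * x g = (2 * T.card - n) * x g - T.card * (T.card - n) := by
    intro g
    obtain ⟨m, hm⟩ := hdvd g
    obtain ⟨h₁, h₂⟩ := abs_le.1 (habs g)
    have hn' : (T.card : ℤ) < n := by exact_mod_cast hn
    have hm₀ : m = 0 ∨ m = -1 := by
      have : m < 1 := by by_contra! h; nlinarith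
      have : -2 < m := by by_contra! h; nlinarith
      omega
    have hxg : x g = T.card + n * m := by linarith
    rcases hm₀ with rfl | rfl <;> rw [hxg] <;> ring
  simp_rw [hval, sum_sub_distrib, ← mul_sum, hsum, sum_const, card_univ, nsmul_eq_mul] at hsq
  have hG : (Fintype.card G : ℤ) ≠ 0 := by exact_mod_cast Fintype.card_ne_zero
  have h : (T.card : ℤ) * (T.card + 1 - n) = 0 := by
    refine (mul_eq_zero.1 (?_ : (Fintype.card G : ℤ) * _ = 0)).resolve_left hG
    linear_combination -hsq
  rcases mul_eq_zero.1 h with h | h <;> [left; right] <;> omega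

/-! ### Character values of a regular partial difference set. -/

section RegularPDS

variable {G : Type*} [Group G] {D : Finset G} {v k lam mu : ℕ}

lemma IsRegularPDS.charSum_inv (hD : IsRegularPDS D v k lam mu) (ξ : LinChar G) :
    ∑ d ∈ D, ((ξ d⁻¹ : ℂˣ) : ℂ) = charSum ξ D :=
  sum_nbij' (·⁻¹) (·⁻¹) hD.inv_mem hD.inv_mem (by simp) (by simp) (by simp)

/-- Nonprincipal character values are roots of `X ^ 2 - (lam - mu) X - (k - mu)`. -/
lemma IsRegularPDS.charSum_mul_self [Finite G] (hD : IsRegularPDS D v k lam mu) {ξ : LinChar G}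
    (hξ : ξ ≠ 1) :
    charSum ξ D * charSum ξ D = (k - mu) + (lam - mu) * charSum ξ D := by
  classical
  have : Fintype G := Fintype.ofFinite G
  -- Coefficients of `D * D⁻¹` in the group ring. At `g = 1` the count is `k`, and the middle term
  -- vanishes because `1 ∉ D`.
  have hcount : ∀ g : G, (#{p ∈ D ×ˢ D | p.1 * p.2⁻¹ = g} : ℂ) =
      mu + (lam - mu) * (if g ∈ D then 1 else 0) + (k - mu) * (if g = 1 then 1 else 0) := by
    intro g
    have hset : {p : G × G | p.1 ∈ D ∧ p.2 ∈ D ∧ p.1 * p.2⁻¹ = g}.ncard =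
        #{p ∈ D ×ˢ D | p.1 * p.2⁻¹ = g} := by
      rw [← Set.ncard_coe_finset]
      congr 1
      ext p
      simp [and_assoc]
    rcases eq_or_ne g 1 with rfl | hg
    · have : #{p ∈ D ×ˢ D | p.1 * p.2⁻¹ = 1} = k := by
        rw [← hD.card_set]
        refine card_nbij' Prod.fst (fun d ↦ (d, d)) ?_ ?_ ?_ ?_ <;>
          simp +contextual [mul_inv_eq_one, Set.MapsTo, Set.LeftInvOn]
      simp [this, hD.one_not_mem]
    · by_cases hgD : g ∈ D
      · simp [← hset, hD.count_mem g hg hgD, hg, hgD]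
      · simp [← hset, hD.count_not_mem g hg hgD, hg, hgD]
  calc charSum ξ D * charSum ξ D
      = ∑ p ∈ D ×ˢ D, ((ξ (p.1 * p.2⁻¹) : ℂˣ) : ℂ) := by
        nth_rw 2 [← hD.charSum_inv]
        rw [charSum, sum_mul_sum, sum_product]
        simp
    _ = ∑ g : G, (#{p ∈ D ×ˢ D | p.1 * p.2⁻¹ = g} : ℂ) * ((ξ g : ℂˣ) : ℂ) := by
        rw [← sum_fiberwise (D ×ˢ D) (fun p ↦ p.1 * p.2⁻¹)]
        refine sum_congr rfl fun g _ ↦ ?_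
        rw [sum_congr rfl (g := fun _ ↦ ((ξ g : ℂˣ) : ℂ))
          (fun p hp ↦ by rw [(mem_filter.1 hp).2])]
        simp
    _ = (k - mu) + (lam - mu) * charSum ξ D := by
        simp_rw [hcount, add_mul, sum_add_distrib, mul_assoc, ← mul_sum, sum_linChar_eq_zero hξ]
        simp [charSum]
        ring

/-- When the discriminant is a square, the eigenvalues are integers. -/
lemma exists_int_theta {s : ℕ} (hs : (s : ℤ) ^ 2 = discr k lam mu) :
    ∃ t₁ t₂ : ℤ, theta₁ k lam mu = t₁ ∧ theta₂ k lam mu = t₂ ∧ t₁ - t₂ = s ∧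
      t₁ + t₂ = lam - mu ∧ t₁ * t₂ = mu - k := by
  have hsqrt : Real.sqrt (discr k lam mu : ℝ) = s := by
    rw [← hs]
    push_cast
    exact Real.sqrt_sq (Nat.cast_nonneg s)
  -- `s²` and `(lam - mu)²` differ by a multiple of `4`, so `s` and `lam - mu` have equal parity.
  have hpar : Even ((lam : ℤ) - mu + s) := by
    have h : Even ((s : ℤ) ^ 2 - ((lam : ℤ) - mu) ^ 2) := by
      rw [hs, discr]
      exact ⟨2 * ((k : ℤ) - mu), by ring⟩
    simpa [Int.even_sub, Int.even_add, Int.even_pow, iff_comm] using h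
  obtain ⟨t, ht⟩ := hpar
  refine ⟨t, t - s, ?_, ?_, by ring, by linarith, ?_⟩
  · rw [theta₁, hsqrt]
    have : (lam : ℝ) - mu + s = t + t := by exact_mod_cast ht
    linarith
  · rw [theta₂, hsqrt]
    have : (lam : ℝ) - mu + s = t + t := by exact_mod_cast ht
    push_cast
    linarith
  · rw [discr] at hs
    have hl : (lam : ℤ) - mu = 2 * t - s := by linarith
    rw [hl] at hs
    linarith

lemma IsRegularPDS.charSum_eq_or [Finite G] (hD : IsRegularPDS D v k lam mu) {ξ : LinChar G}
    (hξ : ξ ≠ 1) {t₁ t₂ : ℤ} (hadd : t₁ + t₂ = lam - mu) (hmul : t₁ * t₂ = mu - k) :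
    charSum ξ D = t₁ ∨ charSum ξ D = t₂ := by
  have hadd' : (t₁ : ℂ) + t₂ = lam - mu := by exact_mod_cast hadd
  have hmul' : (t₁ : ℂ) * t₂ = mu - k := by exact_mod_cast hmul
  have h : (charSum ξ D - t₁) * (charSum ξ D - t₂) = 0 := by
    linear_combination hD.charSum_mul_self hξ - charSum ξ D * hadd' + hmul'
  exact (mul_eq_zero.1 h).imp sub_eq_zero.1 sub_eq_zero.1

end RegularPDS

/-! ### Fourier inversion on cosets and constancy of the character values. -/

lemma mem_rCoset {G : Type*} [Group G] {N : Subgroup G} {a g : G} :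
    g ∈ rCoset N a ↔ g * a⁻¹ ∈ N := by
  simp [rCoset]

/-- Fourier inversion on the cosets of `kerInter H`. -/
lemma sum_charSum_mul_inv {G : Type*} [Group G] (D : Finset G) (H : Subgroup (LinChar G))
    [Fintype H] (a : G) :
    ∑ ξ : H, charSum (ξ : LinChar G) D * (((ξ : LinChar G) a⁻¹ : ℂˣ) : ℂ) =
      Fintype.card H * (rCoset (kerInter H) a ∩ (D : Set G)).ncard := by
  classical
  have hset : rCoset (kerInter H) a ∩ (D : Set G) = ({d ∈ D | d * a⁻¹ ∈ kerInter H} : Finset G) := by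
    ext g
    simp [mem_rCoset, and_comm]
  rw [hset, Set.ncard_coe_finset]
  simp_rw [charSum, sum_mul]
  rw [sum_comm]
  simp_rw [← Units.val_mul, ← map_mul, sum_subgroup_apply]
  simp [← sum_filter, mul_comm]

/-- If all nonprincipal characters of `H` agree on `D`, then `D` is equidistributed over the
nontrivial cosets of `kerInter H`. -/
lemma ncard_rCoset_inter_of_charSum_eq {G : Type*} [Group G] [Finite G] (D : Finset G)
    (H : Subgroup (LinChar G)) {θ : ℝ} (hθ : ∀ ξ ∈ H, ξ ≠ 1 → charSum ξ D = (θ : ℂ)) {a : G}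
    (ha : a ∉ kerInter H) :
    ((rCoset (kerInter H) a ∩ (D : Set G)).ncard : ℝ) = (D.card - θ) / Nat.card H := by
  classical
  have := finite_linChar (G := G)
  have : Fintype H := Fintype.ofFinite H
  have h := sum_charSum_mul_inv D H a
  have hval : ∀ ξ : H, charSum (ξ : LinChar G) D * (((ξ : LinChar G) a⁻¹ : ℂˣ) : ℂ) =
      θ * (((ξ : LinChar G) a⁻¹ : ℂˣ) : ℂ) + if ξ = 1 then (D.card - θ : ℂ) else 0 := by
    intro ξ
    split_ifs with hξ
    · simp [hξ, charSum]
    · rw [hθ ξ ξ.2 (by simpa using hξ), add_zero]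
  simp_rw [hval, sum_add_distrib, ← mul_sum, sum_subgroup_apply] at h
  rw [if_neg (by simpa using ha)] at h
  simp only [mul_zero, sum_ite_eq', mem_univ, if_true, zero_add] at h
  have hr : (D.card : ℝ) - θ = Fintype.card H * (rCoset (kerInter H) a ∩ (D : Set G)).ncard := by
    exact_mod_cast h
  have hH : (Fintype.card H : ℝ) ≠ 0 := by exact_mod_cast Fintype.card_ne_zero
  rw [hr, Nat.card_eq_fintype_card, mul_div_cancel_left₀ _ hH]

/-- All nonprincipal characters of a group of characters of order coprime to `√Δ` take the same
value on a regular partial difference set. -/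
lemma IsRegularPDS.exists_charSum_eq {G : Type*} [Group G] [Finite G] {D : Finset G}
    {v k lam mu : ℕ} (hD : IsRegularPDS D v k lam mu) (hmuk : mu < k) {s : ℕ}
    (hs : (s : ℤ) ^ 2 = discr k lam mu) (H : Subgroup (LinChar G))
    (hcop : Nat.Coprime (Nat.card H) s) :
    ∃ θ : ℝ, (θ = theta₁ k lam mu ∨ θ = theta₂ k lam mu) ∧
      ∀ ξ ∈ H, ξ ≠ 1 → charSum ξ D = (θ : ℂ) := by
  classical
  have := finite_linChar (G := G)
  have : Fintype H := Fintype.ofFinite H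
  rw [Nat.card_eq_fintype_card] at hcop
  obtain ⟨t₁, t₂, h₁, h₂, hsub, hadd, hmul⟩ := exists_int_theta hs
  have hor : ∀ ξ : H, ξ ≠ 1 → charSum (ξ : LinChar G) D = t₁ ∨ charSum (ξ : LinChar G) D = t₂ :=
    fun ξ hξ ↦ hD.charSum_eq_or (by simpa using hξ) hadd hmul
  have hs₀ : (s : ℤ) ≠ 0 := by
    rintro h
    rw [h, discr] at hs
    have : (mu : ℤ) < k := by exact_mod_cast hmuk
    nlinarith [sq_nonneg ((lam : ℤ) - mu)]
  set T : Finset H := {ξ | ξ ≠ 1 ∧ charSum (ξ : LinChar G) D = t₂} with hTdef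
  set T' : Finset (LinChar G) := T.map (Function.Embedding.subtype _) with hT'def
  have hcard : T'.card = T.card := card_map _
  have hsumT : ∀ g : G, ∑ ξ ∈ T', ((ξ g : ℂˣ) : ℂ) = ∑ ξ ∈ T, (((ξ : LinChar G) g : ℂˣ) : ℂ) :=
    fun g ↦ by simp [hT'def]
  -- Written this way, the transform of `ξ ↦ ξ(D)` isolates the sum over `T`; the last term corrects
  -- the principal character, whose value is `k`.
  have hval : ∀ ξ : H, charSum (ξ : LinChar G) D =
      t₁ - s * (if ξ ∈ T then 1 else 0) + if ξ = 1 then (k - t₁ : ℂ) else 0 := by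
    intro ξ
    have hsub' : (t₁ : ℂ) - t₂ = s := by exact_mod_cast hsub
    by_cases hξ : ξ = 1
    · have hnot : ξ ∉ T := by simp [hTdef, hξ]
      rw [if_neg hnot, if_pos hξ]
      simp [hξ, charSum, hD.card_set]
    · by_cases hξ₂ : charSum (ξ : LinChar G) D = t₂
      · simp [hTdef, hξ, hξ₂, ← hsub']
      · have hnot : ξ ∉ T := by simp [hTdef, hξ₂]
        simp [hnot, hξ, (hor ξ hξ).resolve_right hξ₂]
  have hmain : ∀ g : G, ∃ m : ℤ, (s : ℂ) * ∑ ξ ∈ T', ((ξ g : ℂˣ) : ℂ) =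
      ((k - t₁ - Fintype.card H * m : ℤ) : ℂ) := by
    intro g
    have h := sum_charSum_mul_inv D H g⁻¹
    simp_rw [inv_inv, hval, add_mul, sub_mul, sum_add_distrib, sum_sub_distrib, mul_assoc,
      ← mul_sum, sum_subgroup_apply] at h
    simp only [ite_mul, one_mul, zero_mul, sum_ite_mem, univ_inter, sum_ite_eq', mem_univ,
      if_true, OneMemClass.coe_one, MonoidHom.one_apply, Units.val_one, mul_one] at h
    rw [hsumT]
    -- The coset count comes from inversion at `g⁻¹`, the other term from the constant part `t₁`.
    refine ⟨(rCoset (kerInter H) g⁻¹ ∩ (D : Set G)).ncard -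
      t₁ * if g ∈ kerInter H then 1 else 0, ?_⟩
    push_cast
    rw [show (if g ∈ kerInter H then (Fintype.card H : ℂ) else 0) =
      Fintype.card H * if g ∈ kerInter H then 1 else 0 by simp] at h
    linear_combination -h
  have hint : ∀ g : G, ∃ x : ℤ, ∑ ξ ∈ T', ((ξ g : ℂˣ) : ℂ) = x := by
    intro g
    obtain ⟨m, hm⟩ := hmain g
    exact exists_intCast_eq_of_isIntegral
      (IsIntegral.sum _ fun ξ _ ↦ isIntegral_linChar ξ g) hs₀ (by exact_mod_cast hm)
  choose x hx using hint
  have hdvd : ∀ g, (Fintype.card H : ℤ) ∣ x g - T'.card := by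
    intro g
    obtain ⟨m, hm⟩ := hmain g
    obtain ⟨m₁, hm₁⟩ := hmain 1
    rw [hx] at hm
    simp only [map_one, Units.val_one, sum_const, nsmul_eq_mul, mul_one] at hm₁
    have e : (s : ℤ) * x g = k - t₁ - Fintype.card H * m := by exact_mod_cast hm
    have e₁ : (s : ℤ) * T'.card = k - t₁ - Fintype.card H * m₁ := by exact_mod_cast hm₁
    -- Comparing `g` with `1`, where the sum is `|T'|`, eliminates `k - t₁`; coprimality then
    -- cancels `s`.
    refine (Int.isCoprime_iff_gcd_eq_one.2 (by simpa using hcop)).dvd_of_dvd_mul_left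
      (show (Fintype.card H : ℤ) ∣ s * (x g - T'.card) from ⟨m₁ - m, ?_⟩)
    linear_combination e - e₁
  have hsubset : T ⊆ univ.erase 1 := fun ξ hξ ↦ by simpa using (mem_filter.1 hξ).2.1
  have hcard_erase : (univ.erase (1 : H)).card + 1 = Fintype.card H :=
    card_erase_add_one (mem_univ 1)
  have hlt : T'.card < Fintype.card H := by
    have := card_le_card hsubset
    omega
  have hone : 1 ∉ T' := by
    simp [hT'def, hTdef]
  rcases card_eq_zero_or_card_add_one_eq T' hone hlt x hx hdvd with h | h
  · refine ⟨theta₁ k lam mu, Or.inl rfl, fun ξ hξ hne ↦ ?_⟩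
    have hne' : (⟨ξ, hξ⟩ : H) ≠ 1 := by simpa [Subtype.ext_iff] using hne
    have hnot : (⟨ξ, hξ⟩ : H) ∉ T := by
      rw [hcard, card_eq_zero] at h
      simp [h]
    rw [h₁, Complex.ofReal_intCast]
    exact (hor ⟨ξ, hξ⟩ hne').resolve_right fun h' ↦ hnot (mem_filter.2 ⟨mem_univ _, hne', h'⟩)
  · refine ⟨theta₂ k lam mu, Or.inr rfl, fun ξ hξ hne ↦ ?_⟩
    have hne' : (⟨ξ, hξ⟩ : H) ≠ 1 := by simpa [Subtype.ext_iff] using hne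
    have hmem : (⟨ξ, hξ⟩ : H) ∈ T := by
      rw [eq_of_subset_of_card_le hsubset (by omega)]
      simpa using hne'
    rw [h₂, Complex.ofReal_intCast]
    exact (mem_filter.1 hmem).2.2

end PartialDifference

/-- Here `s` is the (integral) square root of the discriminant `Δ`, and in each of the two parts
`θ` is the common value `ξ(D)` of the nonprincipal linear characters concerned. -/
theorem theorem3p17 {G : Type*} [Group G] [Finite G] (D : Finset G) (v k lam mu : ℕ)
    (hD : PartialDifference.IsRegularPDS D v k lam mu)
    (hmu : 0 < mu) (hmuk : mu < k)
    (s : ℕ) (hs : (s : ℤ) ^ 2 = PartialDifference.discr k lam mu) :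
    (∀ H : Subgroup (PartialDifference.LinChar G), Nat.Coprime (Nat.card H) s →
      PartialDifference.kerInter H < ⊤ →
      ∃ θ : ℝ,
        (θ = PartialDifference.theta₁ k lam mu ∨ θ = PartialDifference.theta₂ k lam mu) ∧
        (∀ ξ ∈ H, ξ ≠ 1 → PartialDifference.charSum ξ D = (θ : ℂ)) ∧
        ∀ a : G, a ∉ PartialDifference.kerInter H →
          ((PartialDifference.rCoset (PartialDifference.kerInter H) a ∩ (D : Set G)).ncard : ℝ)
            = ((k : ℝ) - θ) / (Nat.card H : ℝ)) ∧
    (Nat.Coprime v s →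
      ∃ θ : ℝ,
        (θ = PartialDifference.theta₁ k lam mu ∨ θ = PartialDifference.theta₂ k lam mu) ∧
        (∀ ξ : PartialDifference.LinChar G, ξ ≠ 1 →
          PartialDifference.charSum ξ D = (θ : ℂ)) ∧
        ∀ a : G, a ∉ commutator G →
          ((PartialDifference.rCoset (commutator G) a ∩ (D : Set G)).ncard : ℝ)
            = ((k : ℝ) - θ) / (Nat.card (PartialDifference.LinChar G) : ℝ)) := by
  have main : ∀ H : Subgroup (PartialDifference.LinChar G), Nat.Coprime (Nat.card H) s →
      ∃ θ : ℝ,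
        (θ = PartialDifference.theta₁ k lam mu ∨ θ = PartialDifference.theta₂ k lam mu) ∧
        (∀ ξ ∈ H, ξ ≠ 1 → PartialDifference.charSum ξ D = (θ : ℂ)) ∧
        ∀ a : G, a ∉ PartialDifference.kerInter H →
          ((PartialDifference.rCoset (PartialDifference.kerInter H) a ∩ (D : Set G)).ncard : ℝ)
            = ((k : ℝ) - θ) / (Nat.card H : ℝ) := by
    intro H hcop
    obtain ⟨θ, hθ, h⟩ := hD.exists_charSum_eq hmuk hs H hcop
    refine ⟨θ, hθ, h, fun a ha ↦ ?_⟩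
    rw [PartialDifference.ncard_rCoset_inter_of_charSum_eq D H h ha, hD.card_set]
  refine ⟨fun H hcop _ ↦ main H hcop, fun hcop ↦ ?_⟩
  -- There are `|G/G'|` linear characters, so coprimality passes from `v` to their number.
  have hdvd : Nat.card (⊤ : Subgroup (PartialDifference.LinChar G)) ∣ v := by
    rw [Subgroup.card_top, PartialDifference.card_linChar, ← hD.card_group]
    exact Subgroup.card_quotient_dvd_card _
  obtain ⟨θ, hθ, h, hcard⟩ := main ⊤ (Nat.Coprime.coprime_dvd_left hdvd hcop)
  rw [PartialDifference.kerInter_top, Subgroup.card_top] at hcard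
  exact ⟨θ, hθ, fun ξ ↦ h ξ (Subgroup.mem_top ξ), hcard⟩
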